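/- Let $\mathcal C$ and $\mathcal D$ be monoidal model categories (the tensor product $\wedge$ is biclosed, and the pushout-product axiom and the unit axiom hold; symmetry is not assumed). Let $F\colon\mathcal C\rightleftarrows\mathcal D\colon R$ be a Quillen adjunction whose left adjoint $F$ is a strong monoidal functor, and let $E$ be a cofibrant object of $\mathcal C$. For an object $A$ of a monoidal model category $\mathcal M$, the $A$-local model structure $L_A\mathcal M$, if it exists, is the model structure on the category underlying $\mathcal M$ in which a map $f\colon X\to Y$ is a weak equivalence if and only if $\mathrm{id}_A\wedge f\colon A\wedge X\to A\wedge Y$ is a weak equivalence of $\mathcal M$, the cofibrations are those of $\mathcal M$, and the fibrations are the maps with the right lifting property with respect to all trivial cofibrations of $L_A\mathcal M$. Assume that $L_E\mathcal C$ and $L_{F(E)}\mathcal D$ exist. Then: 1. The functors $F$ and $R$ form a strong monoidal Quillen adjunction $F\colon L_E\mathcal C\rightleftarrows L_{F(E)}\mathcal D\colon R$. That is, $F$ (which is strong monoidal) preserves cofibrations and trivial cofibrations of the localised model structures, and for every trivial fibration $q\colon Q\to 1_{\mathcal C}$ of $L_E\mathcal C$ with $Q$ cofibrant, the composite $F(Q)\to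 F(1_{\mathcal C})\cong 1_{\mathcal D}$ is a weak equivalence of $L_{F(E)}\mathcal D$. 2. If $F\dashv R$ is a Quillen equivalence between $\mathcal C$ and $\mathcal D$, then it is also a Quillen equivalence between $L_E\mathcal C$ and $L_{F(E)}\mathcal D$. 3. If the monoidal category $\mathcal C$ is braided (in particular, if it is symmetric), then $L_E\mathcal C$ is a monoidal model category; likewise, if $\mathcal D$ is braided, then $L_{F(E)}\mathcal D$ is a monoidal model category. If $\mathcal C$ and $\mathcal D$ are symmetric and $F$ is strong symmetric monoidal, then $F\colon L_E\mathcal C\rightleftarrows L_{F(E)}\mathcal D\colon R$ is a strong symmetric monoidal Quillen adjunction between symmetric monoidal model categories. -/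

import Mathlib

open CategoryTheory Limits MonoidalCategory HomotopicalAlgebra

/-! Several model structures on one category are compared, so model structures are explicit
arguments below instead of instances. -/

universe v₁ v₂ u₁ u₂

section ModelStructures

variable {C : Type u₁} [Category.{v₁} C] {D : Type u₂} [Category.{v₂} D]

/-- `X` is cofibrant in the model structure `M`. -/
def CofibrantIn (M : ModelCategory C) (X : C) : Prop := IsCofibrant X

/-- `X` is fibrant in the model structure `M`. -/
def FibrantIn (M : ModelCategory C) (X : C) : Prop := IsFibrant X

/-- `f` is a cofibration in the model structure `M`. -/
def IsCof (M : ModelCategory C) {X Y : C} (f : X ⟶ Y) : Prop := Cofibration f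

/-- `f` is a fibration in the model structure `M`. -/
def IsFib (M : ModelCategory C) {X Y : C} (f : X ⟶ Y) : Prop := Fibration f

/-- `f` is a weak equivalence in the model structure `M`. -/
def IsWeq (M : ModelCategory C) {X Y : C} (f : X ⟶ Y) : Prop := WeakEquivalence f

/-- `F ⊣ R` is a Quillen adjunction: `F` preserves cofibrations and trivial cofibrations. -/
structure IsQuillenAdjunction (MC : ModelCategory C) (MD : ModelCategory D)
    {F : C ⥤ D} {R : D ⥤ C} (adj : F ⊣ R) : Prop where
  map_cof : ∀ {X Y : C} (f : X ⟶ Y), IsCof MC f → IsCof MD (F.map f)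
  map_trivialCof : ∀ {X Y : C} (f : X ⟶ Y), IsCof MC f → IsWeq MC f →
    IsCof MD (F.map f) ∧ IsWeq MD (F.map f)

/-- `F ⊣ R` is a Quillen equivalence: a Quillen adjunction such that, for `X` cofibrant and `Y`
fibrant, a map `F X ⟶ Y` is a weak equivalence if and only if its adjoint `X ⟶ R Y` is one. -/
structure IsQuillenEquivalence (MC : ModelCategory C) (MD : ModelCategory D)
    {F : C ⥤ D} {R : D ⥤ C} (adj : F ⊣ R) : Prop extends IsQuillenAdjunction MC MD adj where
  weq_iff : ∀ (X : C) (Y : D), CofibrantIn MC X → FibrantIn MD Y → ∀ f : F.obj X ⟶ Y,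
    IsWeq MD f ↔ IsWeq MC (adj.homEquiv X Y f)

variable [MonoidalCategory C] [MonoidalCategory D]

/-- The pushout-product `A ⊗ Y ⨿_{A ⊗ X} B ⊗ X ⟶ B ⊗ Y` of `f : A ⟶ B` and `g : X ⟶ Y`, as an
object of the arrow category (pushouts exist because `M` is a model structure). -/
noncomputable def pushoutProd (M : ModelCategory C) {A B X Y : C} (f : A ⟶ B) (g : X ⟶ Y) :
    CategoryTheory.Arrow C :=
  (MonoidalCategory.Arrow.pushoutProduct.obj (CategoryTheory.Arrow.mk f)).obj
    (CategoryTheory.Arrow.mk g)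

/-- The model structure `M` makes the monoidal category `C` a monoidal model category: the tensor
product is closed on both sides, and the pushout-product axiom and the unit axiom hold. -/
structure IsMonoidalModelCategory (M : ModelCategory C) : Prop where
  tensorLeft_isLeftAdjoint : ∀ X : C, (tensorLeft X).IsLeftAdjoint
  tensorRight_isLeftAdjoint : ∀ X : C, (tensorRight X).IsLeftAdjoint
  pushoutProd_cof : ∀ {A B X Y : C} (f : A ⟶ B) (g : X ⟶ Y), IsCof M f → IsCof M g →
    IsCof M (pushoutProd M f g).hom
  pushoutProd_weq : ∀ {A B X Y : C} (f : A ⟶ B) (g : X ⟶ Y), IsCof M f → IsCof M g →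
    (IsWeq M f ∨ IsWeq M g) → IsWeq M (pushoutProd M f g).hom
  unit_weq : ∀ {Q : C} (q : Q ⟶ 𝟙_ C), CofibrantIn M Q → IsFib M q → IsWeq M q →
    ∀ X : C, CofibrantIn M X → IsWeq M (q ▷ X) ∧ IsWeq M (X ◁ q)

/-- `ML` is the `E`-local model structure `L_E C` attached to the model structure `M` on `C`.
That `L_E C` exists means that there is such an `ML`; it is then unique. -/
structure IsLocalModelStructure (M : ModelCategory C) (E : C) (ML : ModelCategory C) : Prop where
  weq_iff : ∀ {X Y : C} (f : X ⟶ Y), IsWeq ML f ↔ IsWeq M (E ◁ f)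
  cof_iff : ∀ {X Y : C} (f : X ⟶ Y), IsCof ML f ↔ IsCof M f
  fib_iff : ∀ {X Y : C} (p : X ⟶ Y), IsFib ML p ↔
    ∀ {A B : C} (i : A ⟶ B), IsCof ML i → IsWeq ML i → HasLiftingProperty i p

/-- `F ⊣ R` is a strong monoidal Quillen adjunction: a Quillen adjunction whose left adjoint is
strong monoidal and sends a cofibrant replacement of the unit to a weak equivalence. -/
structure IsStrongMonoidalQuillenAdjunction (MC : ModelCategory C) (MD : ModelCategory D)
    {F : C ⥤ D} [F.Monoidal] {R : D ⥤ C} (adj : F ⊣ R) : Prop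
    extends IsQuillenAdjunction MC MD adj where
  unit_weq : ∀ {Q : C} (q : Q ⟶ 𝟙_ C), CofibrantIn MC Q → IsFib MC q → IsWeq MC q →
    IsWeq MD (F.map q ≫ Functor.OplaxMonoidal.η F)

/-- The strong monoidal functor `F` is symmetric: it is compatible with the braidings. -/
def PreservesBraiding [BraidedCategory C] [BraidedCategory D] (F : C ⥤ D) [F.Monoidal] : Prop :=
  ∀ X Y : C, Functor.LaxMonoidal.μ F X Y ≫ F.map (β_ X Y).hom =
    (β_ (F.obj X) (F.obj Y)).hom ≫ Functor.LaxMonoidal.μ F Y X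

/-- `F ⊣ R` is a strong symmetric monoidal Quillen adjunction between symmetric monoidal model
categories. -/
structure IsStrongSymmetricMonoidalQuillenAdjunction [SymmetricCategory C] [SymmetricCategory D]
    (MC : ModelCategory C) (MD : ModelCategory D)
    {F : C ⥤ D} [F.Monoidal] {R : D ⥤ C} (adj : F ⊣ R) : Prop
    extends IsStrongMonoidalQuillenAdjunction MC MD adj where
  source : IsMonoidalModelCategory MC
  target : IsMonoidalModelCategory MD
  symmetric : PreservesBraiding F

end ModelStructures

/-! The cofibrations of `L_E C` are those of `C`, hence so are its trivial fibrations. For `E`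
cofibrant the functor `E ⊗ -` is left Quillen, so trivial cofibrations of `C` are `E`-local
equivalences; factoring, every weak equivalence of `C` is one, and `L_E C` is a left Bousfield
localization of `C`. As `F` is strong monoidal, `F f` is an `F E`-local equivalence if and only if
`F (E ⊗ f)` is a weak equivalence of `D`, which reduces statements about the localizations to
statements about `F` applied to maps `E ⊗ f`. For Quillen equivalences one first replaces the
adjoint `X ⟶ R Y` of `F X ⟶ Y` by a lift `X ⟶ Q` to a cofibrant replacement `Q` of `R Y`. This
does not affect the Quillen condition: local fibrant objects are fibrant, so `F Q ⟶ Y` is a weak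
equivalence of `D`. For the pushout-product axiom, `E ⊗ (f □ g) ≅ (E ⊗ f) □ g`, and a braiding
lets `f` and `g` be exchanged. -/

section ModelStructureAPI

variable {C : Type u₁} [Category.{v₁} C] {M : ModelCategory C} {X Y Z X' Y' : C}

lemma isWeq_iff_of_arrowIso {f : X ⟶ Y} {g : X' ⟶ Y'} (e : Arrow.mk f ≅ Arrow.mk g) :
    IsWeq M f ↔ IsWeq M g := by
  simp only [IsWeq, weakEquivalence_iff]
  exact (weakEquivalences C).arrow_mk_iso_iff e

lemma isCof_iff_of_arrowIso {f : X ⟶ Y} {g : X' ⟶ Y'} (e : Arrow.mk f ≅ Arrow.mk g) :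
    IsCof M f ↔ IsCof M g := by
  simp only [IsCof, cofibration_iff]
  exact (cofibrations C).arrow_mk_iso_iff e

lemma IsWeq.of_isIso (f : X ⟶ Y) [IsIso f] : IsWeq M f :=
  inferInstanceAs (WeakEquivalence f)

lemma IsWeq.postcomp_iff {f : X ⟶ Y} {g : Y ⟶ Z} (hg : IsWeq M g) :
    IsWeq M (f ≫ g) ↔ IsWeq M f :=
  have : WeakEquivalence g := hg
  weakEquivalence_postcomp_iff f g

lemma IsWeq.precomp_iff {f : X ⟶ Y} {g : Y ⟶ Z} (hf : IsWeq M f) :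
    IsWeq M (f ≫ g) ↔ IsWeq M g :=
  have : WeakEquivalence f := hf
  weakEquivalence_precomp_iff f g

lemma cofibrantIn_iff_of_isInitial {I : C} (hI : IsInitial I) (i : I ⟶ X) :
    CofibrantIn M X ↔ IsCof M i :=
  isCofibrant_iff_of_isInitial i hI

lemma CofibrantIn.of_isCof (hX : CofibrantIn M X) {i : X ⟶ Y} (hi : IsCof M i) :
    CofibrantIn M Y :=
  have : IsCofibrant X := hX
  have : Cofibration i := hi
  isCofibrant_of_cofibration i

lemma CofibrantIn.of_iso (hX : CofibrantIn M X) (e : X ≅ Y) : CofibrantIn M Y :=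
  hX.of_isCof (i := e.hom) (inferInstanceAs (Cofibration e.hom))

lemma isFib_and_isWeq_iff_forall_isCof (M : ModelCategory C) (p : X ⟶ Y) :
    IsFib M p ∧ IsWeq M p ↔
      ∀ {A B : C} (i : A ⟶ B), IsCof M i → HasLiftingProperty i p := by
  have h : trivialFibrations C p ↔ IsFib M p ∧ IsWeq M p := mem_trivialFibrations_iff p
  rw [← h, ← cofibrations_rlp]
  exact ⟨fun hp _ _ i hi ↦ hp i hi.mem, fun hp _ _ i hi ↦ hp i ⟨hi⟩⟩

lemma isFib_iff_forall_isCof_isWeq (M : ModelCategory C) (p : X ⟶ Y) :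
    IsFib M p ↔
      ∀ {A B : C} (i : A ⟶ B), IsCof M i → IsWeq M i → HasLiftingProperty i p := by
  have h : fibrations C p ↔ IsFib M p := (fibration_iff p).symm
  rw [← h, ← trivialCofibrations_rlp]
  exact ⟨fun hp _ _ i hi hi' ↦ hp i ⟨hi.mem, hi'.mem⟩, fun hp _ _ i hi ↦ hp i ⟨hi.1⟩ ⟨hi.2⟩⟩

lemma exists_isCof_isWeq_isFib_fac (M : ModelCategory C) (f : X ⟶ Y) :
    ∃ (Z : C) (i : X ⟶ Z) (p : Z ⟶ Y), IsCof M i ∧ IsWeq M i ∧ IsFib M p ∧ i ≫ p = f :=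
  let d := MorphismProperty.factorizationData (trivialCofibrations C) (fibrations C) f
  ⟨d.Z, d.i, d.p, ⟨d.hi.1⟩, ⟨d.hi.2⟩, ⟨d.hp⟩, d.fac⟩

lemma exists_cofibrantIn_isFib_isWeq (M : ModelCategory C) (X : C) :
    ∃ (Q : C) (q : Q ⟶ X), CofibrantIn M Q ∧ IsFib M q ∧ IsWeq M q :=
  let d := MorphismProperty.factorizationData (cofibrations C) (trivialFibrations C)
    (initial.to X)
  ⟨d.Z, d.p, (cofibrantIn_iff_of_isInitial initialIsInitial d.i).2 ⟨d.hi⟩, ⟨d.hp.1⟩, ⟨d.hp.2⟩⟩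

lemma exists_fibrantIn_isWeq (M : ModelCategory C) (X : C) :
    ∃ (Y : C) (j : X ⟶ Y), FibrantIn M Y ∧ IsWeq M j := by
  obtain ⟨Y, j, p, -, hj, hp, -⟩ := exists_isCof_isWeq_isFib_fac M (terminal.from X)
  exact ⟨Y, j, (isFibrant_iff_of_isTerminal p terminalIsTerminal).2 hp, hj⟩

lemma CofibrantIn.exists_lift (hX : CofibrantIn M X) {p : Y ⟶ Z} (hp : IsFib M p)
    (hp' : IsWeq M p) (f : X ⟶ Z) : ∃ g : X ⟶ Y, g ≫ p = f := by
  have := (isFib_and_isWeq_iff_forall_isCof M p).1 ⟨hp, hp'⟩ (initial.to X) hX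
  have sq : CommSq (initial.to Y) (initial.to X) p f := ⟨Subsingleton.elim _ _⟩
  exact ⟨sq.lift, sq.fac_right⟩

/-- Ken Brown's lemma. -/
lemma CofibrantIn.map_mem_of_isWeq {D : Type u₂} [Category.{v₂} D] (F : C ⥤ D)
    (W : MorphismProperty D) [W.HasTwoOutOfThreeProperty] [W.ContainsIdentities]
    (hF : ∀ {A B : C} (i : A ⟶ B), CofibrantIn M A → CofibrantIn M B → IsCof M i → IsWeq M i →
      W (F.map i))
    (hX : CofibrantIn M X) (hY : CofibrantIn M Y) {f : X ⟶ Y} (hf : IsWeq M f) :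
    W (F.map f) := by
  have : IsCofibrant X := hX
  have : IsCofibrant Y := hY
  have : WeakEquivalence f := hf
  let b : CofibrantBrownFactorization f := Classical.arbitrary _
  have hZ : CofibrantIn M b.Z := hY.of_isCof b.cofibration_s
  have hi : W (F.map b.i) := hF b.i hX hZ ⟨b.hi⟩ (inferInstanceAs (WeakEquivalence b.i))
  have hs : W (F.map b.s) := hF b.s hY hZ b.cofibration_s (inferInstanceAs (WeakEquivalence b.s))
  have hp : W (F.map b.p) := by
    refine W.of_precomp _ _ hs ?_
    rw [← F.map_comp, b.s_p, F.map_id]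
    exact W.id_mem _
  rw [← b.fac, F.map_comp]
  exact W.comp_mem _ _ hi hp

end ModelStructureAPI

section QuillenAdjunctions

variable {C : Type u₁} [Category.{v₁} C] {D : Type u₂} [Category.{v₂} D]
  {MC : ModelCategory C} {MD : ModelCategory D} {F : C ⥤ D} {R : D ⥤ C} {adj : F ⊣ R} {X Y : C}

lemma IsQuillenAdjunction.map_cofibrantIn (h : IsQuillenAdjunction MC MD adj)
    (hX : CofibrantIn MC X) : CofibrantIn MD (F.obj X) :=
  have := adj.leftAdjoint_preservesColimits
  (cofibrantIn_iff_of_isInitial (initialIsInitial.isInitialObj F _) (F.map (initial.to X))).2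
    (h.map_cof _ hX)

lemma IsQuillenAdjunction.map_isWeq (h : IsQuillenAdjunction MC MD adj)
    (hX : CofibrantIn MC X) (hY : CofibrantIn MC Y) {f : X ⟶ Y} (hf : IsWeq MC f) :
    IsWeq MD (F.map f) :=
  ⟨hX.map_mem_of_isWeq F (weakEquivalences D)
    (fun i _ _ hi hi' ↦ (h.map_trivialCof i hi hi').2.mem) hY hf⟩

lemma IsQuillenEquivalence.isWeq_map_iff (h : IsQuillenEquivalence MC MD adj)
    (hX : CofibrantIn MC X) (hY : CofibrantIn MC Y) (f : X ⟶ Y) :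
    IsWeq MD (F.map f) ↔ IsWeq MC f := by
  obtain ⟨Z, j, hZ, hj⟩ := exists_fibrantIn_isWeq MD (F.obj Y)
  have hj' : IsWeq MC (adj.homEquiv Y Z j) := (h.weq_iff Y Z hY hZ j).1 hj
  calc IsWeq MD (F.map f)
    _ ↔ IsWeq MD (F.map f ≫ j) := hj.postcomp_iff.symm
    _ ↔ IsWeq MC (adj.homEquiv X Z (F.map f ≫ j)) := h.weq_iff X Z hX hZ _
    _ ↔ IsWeq MC (f ≫ adj.homEquiv Y Z j) := by rw [adj.homEquiv_naturality_left]
    _ ↔ IsWeq MC f := hj'.postcomp_iff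

end QuillenAdjunctions

section LeftBousfieldLocalization

variable {C : Type u₁} [Category.{v₁} C] {D : Type u₂} [Category.{v₂} D]

lemma isFib_and_isWeq_iff_of_isCof_iff {M M' : ModelCategory C}
    (hcof : ∀ {A B : C} (i : A ⟶ B), IsCof M i ↔ IsCof M' i) {X Y : C} (p : X ⟶ Y) :
    IsFib M p ∧ IsWeq M p ↔ IsFib M' p ∧ IsWeq M' p := by
  simp only [isFib_and_isWeq_iff_forall_isCof, hcof]

/-- `ML` is a left Bousfield localization of `M`: it has the same cofibrations and at least as many
weak equivalences. No class of maps to be inverted is specified. -/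
structure IsLeftBousfieldLocalization (M ML : ModelCategory C) : Prop where
  cof_iff : ∀ {X Y : C} (f : X ⟶ Y), IsCof ML f ↔ IsCof M f
  weq_of_weq : ∀ {X Y : C} {f : X ⟶ Y}, IsWeq M f → IsWeq ML f

namespace IsLeftBousfieldLocalization

variable {M ML : ModelCategory C}

lemma of_isWeq_of_trivialCof (hcof : ∀ {X Y : C} (f : X ⟶ Y), IsCof ML f ↔ IsCof M f)
    (hweq : ∀ {X Y : C} (f : X ⟶ Y), IsCof M f → IsWeq M f → IsWeq ML f) :
    IsLeftBousfieldLocalization M ML where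
  cof_iff := hcof
  weq_of_weq {X Y f} hf := by
    obtain ⟨Z, i, p, hi, hi', hp, rfl⟩ := exists_isCof_isWeq_isFib_fac M f
    have hp' : IsWeq M p := hi'.precomp_iff.1 hf
    have hpL : IsWeq ML p := ((isFib_and_isWeq_iff_of_isCof_iff hcof p).2 ⟨hp, hp'⟩).2
    exact hpL.postcomp_iff.2 (hweq i hi hi')

lemma cofibrantIn_iff (hL : IsLeftBousfieldLocalization M ML) (X : C) :
    CofibrantIn ML X ↔ CofibrantIn M X :=
  hL.cof_iff (initial.to X)

lemma isFib_and_isWeq_iff (hL : IsLeftBousfieldLocalization M ML) {X Y : C} (p : X ⟶ Y) :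
    IsFib ML p ∧ IsWeq ML p ↔ IsFib M p ∧ IsWeq M p :=
  isFib_and_isWeq_iff_of_isCof_iff hL.cof_iff p

lemma isFib_of_isFib (hL : IsLeftBousfieldLocalization M ML) {X Y : C} {p : X ⟶ Y}
    (hp : IsFib ML p) : IsFib M p :=
  (isFib_iff_forall_isCof_isWeq M p).2 fun i hi hi' ↦
    (isFib_iff_forall_isCof_isWeq ML p).1 hp i ((hL.cof_iff i).2 hi) (hL.weq_of_weq hi')

lemma fibrantIn_of_fibrantIn (hL : IsLeftBousfieldLocalization M ML) {X : C}
    (hX : FibrantIn ML X) : FibrantIn M X :=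
  hL.isFib_of_isFib hX

end IsLeftBousfieldLocalization

variable {MC LC : ModelCategory C} {MD LD : ModelCategory D} {F : C ⥤ D} {R : D ⥤ C} {adj : F ⊣ R}

lemma IsQuillenEquivalence.of_isLeftBousfieldLocalization (h : IsQuillenEquivalence MC MD adj)
    (hLC : IsLeftBousfieldLocalization MC LC) (hLD : IsLeftBousfieldLocalization MD LD)
    (hL : IsQuillenAdjunction LC LD adj)
    (hweq : ∀ {X Y : C} (f : X ⟶ Y), CofibrantIn MC X → CofibrantIn MC Y →
      (IsWeq LD (F.map f) ↔ IsWeq LC f)) :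
    IsQuillenEquivalence LC LD adj where
  toIsQuillenAdjunction := hL
  weq_iff X Y hX hY f := by
    rw [hLC.cofibrantIn_iff] at hX
    replace hY : FibrantIn MD Y := hLD.fibrantIn_of_fibrantIn hY
    obtain ⟨Q, q, hQ, hq, hq'⟩ := exists_cofibrantIn_isFib_isWeq MC (R.obj Y)
    obtain ⟨g, hg⟩ := hX.exists_lift hq hq' (adj.homEquiv X Y f)
    have hf : F.map g ≫ (adj.homEquiv Q Y).symm q = f := by
      rw [← adj.homEquiv_naturality_left_symm, hg, Equiv.symm_apply_apply]
    have hq_symm : IsWeq MD ((adj.homEquiv Q Y).symm q) := by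
      rwa [h.weq_iff Q Y hQ hY, Equiv.apply_symm_apply]
    calc IsWeq LD f
      _ ↔ IsWeq LD (F.map g) := by rw [← hf, (hLD.weq_of_weq hq_symm).postcomp_iff]
      _ ↔ IsWeq LC g := hweq g hX hQ
      _ ↔ IsWeq LC (adj.homEquiv X Y f) := by rw [← hg, (hLC.weq_of_weq hq').postcomp_iff]

end LeftBousfieldLocalization

section PushoutProduct

variable {C : Type u₁} [Category.{v₁} C] [MonoidalCategory C]

/-- The unit law `W ◁ f ≅ (⊥_ C ⟶ W) □ f` of the pushout-product, for a tensor product that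
preserves the initial object in its first variable. -/
noncomputable def whiskerLeftIsoInitialPushoutProduct [HasPushouts C] [HasInitial C] (W : C)
    {X Y : C} (f : X ⟶ Y) [PreservesColimit (Functor.empty.{0} C) (tensorRight X)]
    [PreservesColimit (Functor.empty.{0} C) (tensorRight Y)] :
    Arrow.mk (W ◁ f) ≅
      (MonoidalCategory.Arrow.pushoutProduct.obj (Arrow.mk (initial.to W))).obj (Arrow.mk f) :=
  have : IsIso ((⊥_ C) ◁ f) := isIso_of_isInitial
    (initialIsInitial.isInitialObj (tensorRight X) _)
    (initialIsInitial.isInitialObj (tensorRight Y) _) _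
  have : IsIso (pushout.inl (initial.to W ▷ X) ((⊥_ C) ◁ f)) := pushout_inl_iso_of_right_iso _ _
  let inlIso := asIso (pushout.inl (initial.to W ▷ X) ((⊥_ C) ◁ f))
  Arrow.isoMk inlIso (Iso.refl _) ((pushout.inl_desc _ _ _).trans (Category.comp_id _).symm)

lemma isWeq_pushoutProd_comm [BraidedCategory C] {M N : ModelCategory C} {A B X Y : C}
    (f : A ⟶ B) (g : X ⟶ Y) :
    IsWeq N (pushoutProd M f g).hom ↔ IsWeq N (pushoutProd M g f).hom :=
  isWeq_iff_of_arrowIso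
    (MonoidalCategory.Arrow.PushoutProduct.braiding (Arrow.mk f) (Arrow.mk g))

end PushoutProduct

section MonoidalModelCategories

variable {C : Type u₁} [Category.{v₁} C] [MonoidalCategory C]

namespace IsMonoidalModelCategory

variable {M : ModelCategory C} {E : C}

lemma nonempty_whiskerLeft_iso_pushoutProd (hM : IsMonoidalModelCategory M) (E : C) {X Y : C}
    (f : X ⟶ Y) : Nonempty (Arrow.mk (E ◁ f) ≅ pushoutProd M (initial.to E) f) :=
  have := hM.tensorRight_isLeftAdjoint
  ⟨whiskerLeftIsoInitialPushoutProduct E f⟩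

lemma isCof_whiskerLeft (hM : IsMonoidalModelCategory M) (hE : CofibrantIn M E) {X Y : C}
    {f : X ⟶ Y} (hf : IsCof M f) : IsCof M (E ◁ f) :=
  have ⟨e⟩ := hM.nonempty_whiskerLeft_iso_pushoutProd E f
  (isCof_iff_of_arrowIso e).2 (hM.pushoutProd_cof _ f hE hf)

lemma isWeq_whiskerLeft (hM : IsMonoidalModelCategory M) (hE : CofibrantIn M E) {X Y : C}
    {f : X ⟶ Y} (hf : IsCof M f) (hf' : IsWeq M f) : IsWeq M (E ◁ f) :=
  have ⟨e⟩ := hM.nonempty_whiskerLeft_iso_pushoutProd E f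
  (isWeq_iff_of_arrowIso e).2 (hM.pushoutProd_weq _ f hE hf (.inr hf'))

lemma isQuillenAdjunction_tensorLeft (hM : IsMonoidalModelCategory M) (hE : CofibrantIn M E)
    {G : C ⥤ C} (adj : tensorLeft E ⊣ G) : IsQuillenAdjunction M M adj where
  map_cof _ hf := hM.isCof_whiskerLeft hE hf
  map_trivialCof _ hf hf' := ⟨hM.isCof_whiskerLeft hE hf, hM.isWeq_whiskerLeft hE hf hf'⟩

lemma cofibrantIn_tensor (hM : IsMonoidalModelCategory M) (hE : CofibrantIn M E) {X : C}
    (hX : CofibrantIn M X) : CofibrantIn M (E ⊗ X) :=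
  have := hM.tensorLeft_isLeftAdjoint E
  (hM.isQuillenAdjunction_tensorLeft hE (.ofIsLeftAdjoint _)).map_cofibrantIn hX

end IsMonoidalModelCategory

end MonoidalModelCategories

section LocalModelStructures

variable {C : Type u₁} [Category.{v₁} C] [MonoidalCategory C] {D : Type u₂} [Category.{v₂} D]
  [MonoidalCategory D]

namespace IsLocalModelStructure

variable {M ML : ModelCategory C} {E : C}

lemma isLeftBousfieldLocalization (hL : IsLocalModelStructure M E ML)
    (hM : IsMonoidalModelCategory M) (hE : CofibrantIn M E) : IsLeftBousfieldLocalization M ML :=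
  .of_isWeq_of_trivialCof hL.cof_iff fun f hf hf' ↦
    (hL.weq_iff f).2 (hM.isWeq_whiskerLeft hE hf hf')

lemma isWeq_pushoutProd (hL : IsLocalModelStructure M E ML) (hM : IsMonoidalModelCategory M)
    (hE : CofibrantIn M E) {A B X Y : C} {f : A ⟶ B} {g : X ⟶ Y} (hf : IsCof M f)
    (hg : IsCof M g) (hf' : IsWeq ML f) : IsWeq ML (pushoutProd M f g).hom := by
  have := hM.tensorLeft_isLeftAdjoint E
  let e : Arrow.mk (E ◁ (pushoutProd M f g).hom) ≅ pushoutProd M (E ◁ f) g :=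
    MonoidalCategory.Arrow.PushoutProduct.whiskerLeftIso (Arrow.mk f) (Arrow.mk g)
  rw [hL.weq_iff] at hf' ⊢
  exact (isWeq_iff_of_arrowIso e).2
    (hM.pushoutProd_weq (E ◁ f) g (hM.isCof_whiskerLeft hE hf) hg (.inl hf'))

lemma isMonoidalModelCategory [BraidedCategory C] (hL : IsLocalModelStructure M E ML)
    (hM : IsMonoidalModelCategory M) (hE : CofibrantIn M E) : IsMonoidalModelCategory ML where
  tensorLeft_isLeftAdjoint := hM.tensorLeft_isLeftAdjoint
  tensorRight_isLeftAdjoint := hM.tensorRight_isLeftAdjoint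
  pushoutProd_cof f g hf hg :=
    (hL.cof_iff _).2 (hM.pushoutProd_cof f g ((hL.cof_iff f).1 hf) ((hL.cof_iff g).1 hg))
  pushoutProd_weq f g hf hg h := by
    rw [hL.cof_iff] at hf hg
    rcases h with hf' | hg'
    · exact hL.isWeq_pushoutProd hM hE hf hg hf'
    · exact (isWeq_pushoutProd_comm f g).2 (hL.isWeq_pushoutProd hM hE hg hf hg')
  unit_weq q hQ hq hq' X hX := by
    have hB := hL.isLeftBousfieldLocalization hM hE
    rw [hB.cofibrantIn_iff] at hQ hX
    obtain ⟨hqM, hqM'⟩ := (hB.isFib_and_isWeq_iff q).1 ⟨hq, hq'⟩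
    exact (hM.unit_weq q hQ hqM hqM' X hX).imp hB.weq_of_weq hB.weq_of_weq

lemma isWeq_map_iff {MD LD : ModelCategory D} {F : C ⥤ D} [F.Monoidal]
    (hLD : IsLocalModelStructure MD (F.obj E) LD) {X Y : C} (f : X ⟶ Y) :
    IsWeq LD (F.map f) ↔ IsWeq MD (F.map (E ◁ f)) :=
  (hLD.weq_iff _).trans <| isWeq_iff_of_arrowIso <|
    Arrow.isoMk (Functor.Monoidal.μIso F E X) (Functor.Monoidal.μIso F E Y) (by simp)

end IsLocalModelStructure

variable {MC LC : ModelCategory C} {MD LD : ModelCategory D} {F : C ⥤ D} [F.Monoidal] {R : D ⥤ C}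
  {adj : F ⊣ R} {E : C}

lemma IsQuillenAdjunction.local (hadj : IsQuillenAdjunction MC MD adj)
    (hC : IsMonoidalModelCategory MC) (hE : CofibrantIn MC E)
    (hLC : IsLocalModelStructure MC E LC) (hLD : IsLocalModelStructure MD (F.obj E) LD) :
    IsQuillenAdjunction LC LD adj where
  map_cof f hf := (hLD.cof_iff _).2 (hadj.map_cof f ((hLC.cof_iff f).1 hf))
  map_trivialCof f hf hf' := by
    rw [hLC.cof_iff] at hf
    rw [hLC.weq_iff] at hf'
    rw [hLD.cof_iff, hLD.isWeq_map_iff]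
    exact ⟨hadj.map_cof f hf, (hadj.map_trivialCof _ (hC.isCof_whiskerLeft hE hf) hf').2⟩

lemma IsQuillenAdjunction.isStrongMonoidal_local (hadj : IsQuillenAdjunction MC MD adj)
    (hC : IsMonoidalModelCategory MC) (hE : CofibrantIn MC E)
    (hLC : IsLocalModelStructure MC E LC) (hLD : IsLocalModelStructure MD (F.obj E) LD) :
    IsStrongMonoidalQuillenAdjunction LC LD adj where
  toIsQuillenAdjunction := hadj.local hC hE hLC hLD
  unit_weq {Q} q hQ hq hq' := by
    have hB := hLC.isLeftBousfieldLocalization hC hE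
    rw [hB.cofibrantIn_iff] at hQ
    obtain ⟨hqM, hqM'⟩ := (hB.isFib_and_isWeq_iff q).1 ⟨hq, hq'⟩
    have hEq : IsWeq MC (E ◁ q) := (hC.unit_weq q hQ hqM hqM' E hE).2
    have hE_unit : CofibrantIn MC (E ⊗ 𝟙_ C) := hE.of_iso (ρ_ E).symm
    have hη : IsWeq LD (Functor.OplaxMonoidal.η F) := .of_isIso _
    rw [hη.postcomp_iff, hLD.isWeq_map_iff]
    exact hadj.map_isWeq (hC.cofibrantIn_tensor hE hQ) hE_unit hEq

lemma IsQuillenEquivalence.local (hadj : IsQuillenEquivalence MC MD adj)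
    (hC : IsMonoidalModelCategory MC) (hD : IsMonoidalModelCategory MD) (hE : CofibrantIn MC E)
    (hLC : IsLocalModelStructure MC E LC) (hLD : IsLocalModelStructure MD (F.obj E) LD) :
    IsQuillenEquivalence LC LD adj :=
  hadj.of_isLeftBousfieldLocalization (hLC.isLeftBousfieldLocalization hC hE)
    (hLD.isLeftBousfieldLocalization hD (hadj.map_cofibrantIn hE))
    (hadj.toIsQuillenAdjunction.local hC hE hLC hLD) fun f hX hY ↦
      calc IsWeq LD (F.map f)
        _ ↔ IsWeq MD (F.map (E ◁ f)) := hLD.isWeq_map_iff f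
        _ ↔ IsWeq MC (E ◁ f) :=
          hadj.isWeq_map_iff (hC.cofibrantIn_tensor hE hX) (hC.cofibrantIn_tensor hE hY) _
        _ ↔ IsWeq LC f := (hLC.weq_iff f).symm

end LocalModelStructures

theorem mainTheorem9
    {C : Type u₁} [Category.{v₁} C] [MonoidalCategory C]
    {D : Type u₂} [Category.{v₂} D] [MonoidalCategory D]
    (MC : ModelCategory C) (MD : ModelCategory D)
    (hC : IsMonoidalModelCategory MC) (hD : IsMonoidalModelCategory MD)
    {F : C ⥤ D} [F.Monoidal] {R : D ⥤ C} (adj : F ⊣ R)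
    (hadj : IsQuillenAdjunction MC MD adj)
    (E : C) (hE : CofibrantIn MC E)
    (LC : ModelCategory C) (hLC : IsLocalModelStructure MC E LC)
    (LD : ModelCategory D) (hLD : IsLocalModelStructure MD (F.obj E) LD) :
    IsStrongMonoidalQuillenAdjunction LC LD adj ∧
    (IsQuillenEquivalence MC MD adj → IsQuillenEquivalence LC LD adj) ∧
    (∀ _ : BraidedCategory C, IsMonoidalModelCategory LC) ∧
    (∀ _ : BraidedCategory D, IsMonoidalModelCategory LD) ∧
    (∀ (_ : SymmetricCategory C) (_ : SymmetricCategory D), PreservesBraiding F →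
      IsStrongSymmetricMonoidalQuillenAdjunction LC LD adj) := by
  have hFE : CofibrantIn MD (F.obj E) := hadj.map_cofibrantIn hE
  have hF : IsStrongMonoidalQuillenAdjunction LC LD adj :=
    hadj.isStrongMonoidal_local hC hE hLC hLD
  have hLC_monoidal (_ : BraidedCategory C) : IsMonoidalModelCategory LC :=
    hLC.isMonoidalModelCategory hC hE
  have hLD_monoidal (_ : BraidedCategory D) : IsMonoidalModelCategory LD :=
    hLD.isMonoidalModelCategory hD hFE
  exact ⟨hF, fun hequiv ↦ hequiv.local hC hD hE hLC hLD, hLC_monoidal, hLD_monoidal,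
    fun _ _ hbraiding ↦ ⟨hF, hLC_monoidal inferInstance, hLD_monoidal inferInstance, hbraiding⟩⟩
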